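/- Let $\alpha>0$, $\lambda>1/\alpha$, $\beta>0$, $\overline{\gamma}>0$ and $\varphi>0$. Let $\tau$ be a Gamma random variable with density $\frac{\beta^{\lambda}}{\Gamma(\lambda)}t^{\lambda-1}e^{-\beta t}$, $t>0$, and let $X,Y$ be real random variables which, conditionally on $\tau$, are independent and Gaussian with mean $0$ and variance $\frac{1}{2\tau}$. Let $H=(X^{2}+Y^{2})^{1/\alpha}$ (the $\alpha$-Lomax fading variable), let $\Gamma=\overline{\gamma}\,H/\mathbb{E}[H]$ be the instantaneous signal-to-noise ratio, $\mathcal{M}_{\Gamma}(s)=\mathbb{E}[e^{-s\Gamma}]$, and $$\zeta=\left(\frac{\Gamma(1+\frac1\alpha)\,\Gamma(\lambda-\frac1\alpha)}{\Gamma(\lambda)}\right)^{\alpha}.$$ For parameters $a_j,b_j\in\mathbb{C}$ and $A_j,B_j\ge 0$, the Fox H-function is $${\sf H}^{m,n}_{p,q}\!\left[z\left|\begin{matrix}(a_1,A_1),\dots,(a_p,A_p)\\(b_1,B_1),\dots,(b_q,B_q)\end{matrix}\right.\right]=\frac{1}{2\pi i}\int_{c-i\infty}^{c+i\infty}\frac{\prod_{j=1}^{m}\Gamma(b_j+B_js)\prod_{j=1}^{n}\Gamma(1-a_j-A_js)}{\prod_{j=n+1}^{p}\Gamma(a_j+A_js)\prod_{j=m+1}^{q}\Gamma(1-b_j-B_js)}\,z^{-s}\,ds,$$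 where the line $\operatorname{Re}s=c$ has the poles of the factors $\Gamma(b_j+B_js)$, $j\le m$, on its left and those of the factors $\Gamma(1-a_j-A_js)$, $j\le n$, on its right (a factor with $A_j=0$ is a constant). Then the integral that defines the average bit error rate of a coherent binary modulation with parameter $\varphi$, $$\overline{P_b}=\frac1\pi\int_0^{\pi/2}\mathcal{M}_{\Gamma}\!\left(\frac{\varphi}{\sin^{2}\theta}\right)d\theta,$$ converges; for the parameters below such a line exists, and along each such line the integral that defines ${\sf H}^{1,4}_{4,2}$ converges absolutely with one and the same value; and $$\overline{P_b}=\frac{\alpha}{2\pi\,\Gamma(\lambda)}\,{\sf H}^{1,4}_{4,2}\!\left[\frac{\zeta}{\overline{\gamma}^{\alpha}\varphi^{\alpha}}\left|\begin{matrix}(\frac12,\alpha),(\frac12,0),(1-\lambda,1),(1,\alpha)\\(1,1),(0,\alpha)\end{matrix}\right.\right].$$ -/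

import Mathlib

open MeasureTheory ProbabilityTheory

noncomputable section

namespace FoxH

/-- The Mellin–Barnes integrand of the Fox H-function `H^{m,n}_{p,q}[z | (a_j, A_j); (b_j, B_j)]`:
the product of `Γ(b_j + B_j s)` over the first `m` lower pairs and of `Γ(1 - a_j - A_j s)` over the
first `n` upper pairs, divided by the product of `Γ(1 - b_j - B_j s)` over the other lower pairs and
of `Γ(a_j + A_j s)` over the other upper pairs, times `z ^ (-s)`. -/
def integrand (m n : ℕ) {p q : ℕ} (a : Fin p → ℂ × ℝ) (b : Fin q → ℂ × ℝ) (z s : ℂ) : ℂ :=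
  (∏ j : Fin q, if (j : ℕ) < m then Complex.Gamma ((b j).1 + (b j).2 * s)
      else (Complex.Gamma (1 - (b j).1 - (b j).2 * s))⁻¹) *
  (∏ j : Fin p, if (j : ℕ) < n then Complex.Gamma (1 - (a j).1 - (a j).2 * s)
      else (Complex.Gamma ((a j).1 + (a j).2 * s))⁻¹) *
  z ^ (-s)

/-- The line `Re s = c` separates the poles of `Γ(b_j + B_j s)`, `j ≤ m` (on its left), from the
poles of `Γ(1 - a_j - A_j s)`, `j ≤ n` (on its right). -/
def Separates (m n : ℕ) {p q : ℕ} (a : Fin p → ℂ × ℝ) (b : Fin q → ℂ × ℝ) (c : ℝ) : Prop :=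
  (∀ j : Fin q, (j : ℕ) < m → ∀ (s : ℂ) (k : ℕ), (b j).1 + (b j).2 * s = -(k : ℂ) → s.re < c) ∧
  (∀ j : Fin p, (j : ℕ) < n → ∀ (s : ℂ) (k : ℕ), 1 - (a j).1 - (a j).2 * s = -(k : ℂ) → c < s.re)

/-- The contour integral `(1 / 2πi) ∫ integrand ds` along the line from `c - i∞` to `c + i∞`,
parametrized by `s = c + i t`. -/
def lineIntegral (m n : ℕ) {p q : ℕ} (a : Fin p → ℂ × ℝ) (b : Fin q → ℂ × ℝ) (z : ℂ) (c : ℝ) : ℂ :=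
  (2 * Real.pi * Complex.I)⁻¹ *
    ∫ t : ℝ, integrand m n a b z (c + t * Complex.I) * Complex.I

end FoxH

open Classical in
/-- The Fox H-function `H^{m,n}_{p,q}[z | (a_j, A_j); (b_j, B_j)]`, for parameters whose two families
of poles can be separated by a vertical line: its Mellin–Barnes integral along such a line. -/
def foxH (m n : ℕ) {p q : ℕ} (a : Fin p → ℂ × ℝ) (b : Fin q → ℂ × ℝ) (z : ℂ) : ℂ :=
  if h : ∃ c : ℝ, FoxH.Separates m n a b c then FoxH.lineIntegral m n a b z h.choose else 0

namespace AlphaLomax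

/-- The centred Gaussian law of variance `1 / (2 t)`, as a kernel in `t`. (For `t ≤ 0`, which has
probability zero below, the value is a Dirac mass.) -/
def gaussianKernel : Kernel ℝ ℝ where
  toFun t := gaussianReal 0 (1 / (2 * t)).toNNReal
  measurable' := by
    have h : Measurable (fun t : ℝ => ((0 : ℝ), (1 / (2 * t)).toNNReal)) := by fun_prop
    exact measurable_gaussianReal.comp h

instance : IsMarkovKernel gaussianKernel :=
  ⟨fun t => inferInstanceAs (IsProbabilityMeasure (gaussianReal 0 (1 / (2 * t)).toNNReal))⟩

/-- The physical model of Lomax fading: `τ` is Gamma distributed with density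
`β ^ lam / Γ(lam) * t ^ (lam - 1) * exp (-β t)` on `t > 0` and, given `τ`, the in-phase and quadrature
components `X` and `Y` are independent, Gaussian, of mean `0` and variance `1 / (2 τ)`. -/
structure IsLomaxModel {Ω : Type*} [MeasurableSpace Ω] (P : Measure Ω) (lam β : ℝ)
    (τ X Y : Ω → ℝ) : Prop where
  aemeasurable_tau : AEMeasurable τ P
  aemeasurable_X : AEMeasurable X P
  aemeasurable_Y : AEMeasurable Y P
  law : P.map (fun ω => (τ ω, X ω, Y ω)) = gammaMeasure lam β ⊗ₘ (gaussianKernel ×ₖ gaussianKernel)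

/-- The α-Lomax fading variable `H = (X² + Y²) ^ (1/α)`. -/
def fading {Ω : Type*} (α : ℝ) (X Y : Ω → ℝ) (ω : Ω) : ℝ :=
  (X ω ^ 2 + Y ω ^ 2) ^ (1 / α)

/-- The signal power `Z = H / E[H]`. -/
def power {Ω : Type*} [MeasurableSpace Ω] (P : Measure Ω) (α : ℝ) (X Y : Ω → ℝ) (ω : Ω) : ℝ :=
  fading α X Y ω / ∫ ω', fading α X Y ω' ∂P

/-- The instantaneous signal-to-noise ratio `Γ = γbar * Z`. -/
def snr {Ω : Type*} [MeasurableSpace Ω] (P : Measure Ω) (α γbar : ℝ) (X Y : Ω → ℝ) (ω : Ω) : ℝ :=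
  γbar * power P α X Y ω

/-- The moment generating function in the sign convention of communication theory,
`M_G(s) = E[exp (-s G)]`. -/
def laplaceMGF {Ω : Type*} [MeasurableSpace Ω] (P : Measure Ω) (G : Ω → ℝ) (s : ℝ) : ℝ :=
  mgf G P (-s)

/-- The average bit error rate of a coherent binary modulation with parameter `φ`, for the
instantaneous signal-to-noise ratio `G`. -/
def averageBER {Ω : Type*} [MeasurableSpace Ω] (P : Measure Ω) (G : Ω → ℝ) (φ : ℝ) : ℝ :=
  1 / Real.pi * ∫ θ in (0 : ℝ)..(Real.pi / 2), laplaceMGF P G (φ / Real.sin θ ^ 2)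

/-- The constant `ζ = (Γ(1 + 1/α) Γ(lam - 1/α) / Γ(lam)) ^ α`. -/
def zeta (α lam : ℝ) : ℝ :=
  (Real.Gamma (1 + 1 / α) * Real.Gamma (lam - 1 / α) / Real.Gamma lam) ^ α

/-- The upper parameters `(1/2, α), (1/2, 0), (1 - lam, 1), (1, α)`. -/
def upper (α lam : ℝ) : Fin 4 → ℂ × ℝ :=
  ![(1 / 2, α), (1 / 2, 0), (1 - (lam : ℂ), 1), (1, α)]

/-- The lower parameters `(1, 1), (0, α)`. -/
def lower (α : ℝ) : Fin 2 → ℂ × ℝ :=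
  ![(1, 1), (0, α)]

end AlphaLomax

end

/-! ### Positive real bases of complex powers -/

/-! Write R = X² + Y² and K = φγ̄/E[H]. The bit error rate is 1/π times the integral of exp(-f),
with f = K R^(1/α)/sin²θ on the product of Ω with (0, π/2). The Cahen–Mellin formula expresses
exp(-f) as an integral of Γ(w) f^(-w) over Re w = u > 0. Fubini then leaves only the moments of f,
and these factor because f is a product of a constant, a function of ω and a function of θ.

Given τ = t, R is exponential of rate t, so E[R^s | τ] = τ^(-s) Γ(1+s). Averaging over the Gamma law
gives E[R^s] = β^s Γ(1+s) Γ(λ-s)/Γ(λ) for -1 < Re s < λ (`IsLomaxModel.integral_envelope_cpow`). The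
angular moment is a Beta integral (`integral_sin_sq_cpow`). The case s = 1/α gives E[H] =
(βζ)^(1/α), so β cancels against the scale K.

The substitution s = -w/α turns the w-integral into the Mellin–Barnes integral along Re s = c, where
u = -αc. The separating lines are exactly -1 < c < 0. No contour is shifted: the line integrals
agree because each one, times the same nonzero constant, equals the bit error rate. -/

theorem Complex.ofReal_cpow_eq_exp_log {x : ℝ} (hx : 0 < x) (w : ℂ) :
    (x : ℂ) ^ w = Complex.exp (Real.log x * w) := by
  rw [Complex.cpow_def_of_ne_zero (by exact_mod_cast hx.ne'), Complex.ofReal_log hx.le]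

/-! ### The Gamma function on vertical lines -/

theorem Complex.norm_Gamma_le_Gamma_re {z : ℂ} (hz : 0 < z.re) :
    ‖Complex.Gamma z‖ ≤ Real.Gamma z.re := by
  rw [Complex.Gamma_eq_integral hz, Complex.GammaIntegral, Real.Gamma_eq_integral hz]
  refine (norm_integral_le_integral_norm _).trans_eq ?_
  refine setIntegral_congr_fun measurableSet_Ioi fun x hx => ?_
  simp only [norm_mul, Complex.norm_cpow_eq_rpow_re_of_pos hx, Complex.norm_real,
    Real.norm_eq_abs, abs_of_pos (Real.exp_pos _)]
  simp

theorem Complex.continuous_Gamma_comp {f : ℝ → ℂ} (hf : Continuous f) (h : ∀ t, 0 < (f t).re) :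
    Continuous fun t => Complex.Gamma (f t) := by
  rw [continuous_iff_continuousAt]
  intro t
  refine ContinuousAt.comp (f := f) ?_ hf.continuousAt
  refine (Complex.differentiableAt_Gamma _ fun m hm => ?_).continuousAt
  have := h t
  rw [hm] at this
  simp only [Complex.neg_re, Complex.natCast_re] at this
  have : (0 : ℝ) ≤ m := m.cast_nonneg
  linarith

/-- Two uses of the functional equation give Γ(z) = Γ(z+2)/(z(z+1)). On the line the numerator is
bounded by Γ(u+2), while the denominator grows quadratically in t. No Stirling estimate is needed.
-/
theorem Complex.verticalIntegrable_Gamma {u : ℝ} (hu : 0 < u) :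
    Complex.VerticalIntegrable Complex.Gamma u := by
  unfold Complex.VerticalIntegrable
  have hcont : Continuous fun t : ℝ => Complex.Gamma (u + t * Complex.I) :=
    Complex.continuous_Gamma_comp (by fun_prop) (by simp [hu])
  -- Chosen so that m(1 + t²) ≤ u² + t² = |z|².
  set m : ℝ := min (u ^ 2) 1 with hm
  have hm0 : 0 < m := by positivity
  refine Integrable.mono' (integrable_inv_one_add_sq.const_mul (Real.Gamma (u + 2) / m))
    hcont.aestronglyMeasurable (Filter.Eventually.of_forall fun t => ?_)
  set z : ℂ := u + t * Complex.I with hz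
  have hre : z.re = u := by simp [hz]
  have him : z.im = t := by simp [hz]
  have hz0 : z ≠ 0 := fun h => by rw [h] at hre; simp at hre; linarith
  have hz1 : z + 1 ≠ 0 := fun h => by
    have := congrArg Complex.re h
    simp [hre] at this; linarith
  have hG : Complex.Gamma (z + 2) = (z + 1) * (z * Complex.Gamma z) := by
    rw [← Complex.Gamma_add_one z hz0, ← Complex.Gamma_add_one (z + 1) hz1]
    ring_nf
  have hle : ‖Complex.Gamma (z + 2)‖ ≤ Real.Gamma (u + 2) := by
    have := Complex.norm_Gamma_le_Gamma_re (z := z + 2) (by simp [hre]; linarith)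
    simpa [hre] using this
  have hzsq : ‖z‖ ^ 2 = u ^ 2 + t ^ 2 := by
    rw [Complex.sq_norm, Complex.normSq_apply, hre, him]; ring
  have hzsq1 : ‖z + 1‖ ^ 2 = (u + 1) ^ 2 + t ^ 2 := by
    rw [Complex.sq_norm, Complex.normSq_apply]; simp [hre, him]; ring
  have hmono : ‖z‖ ≤ ‖z + 1‖ := by
    refine le_of_sq_le_sq ?_ (norm_nonneg _)
    rw [hzsq, hzsq1]; nlinarith
  have hlow : m * (1 + t ^ 2) ≤ ‖z + 1‖ * ‖z‖ := by
    calc m * (1 + t ^ 2) ≤ u ^ 2 + t ^ 2 := by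
          nlinarith [min_le_left (u ^ 2) 1, min_le_right (u ^ 2) 1, sq_nonneg t]
      _ = ‖z‖ * ‖z‖ := by rw [← hzsq]; ring
      _ ≤ _ := by gcongr
  rw [hG, norm_mul, norm_mul, ← mul_assoc] at hle
  have h1 : m * (1 + t ^ 2) * ‖Complex.Gamma z‖ ≤ Real.Gamma (u + 2) :=
    (mul_le_mul_of_nonneg_right hlow (norm_nonneg _)).trans hle
  rw [div_mul_eq_mul_div, le_div_iff₀ hm0, ← div_eq_mul_inv, le_div_iff₀ (by positivity)]
  linarith

/-- The Cahen–Mellin integral. -/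
theorem Real.exp_neg_eq_integral_Gamma {u x : ℝ} (hu : 0 < u) (hx : 0 < x) :
    (Real.exp (-x) : ℂ) = (2 * Real.pi : ℂ)⁻¹ *
      ∫ t : ℝ, Complex.Gamma (u + t * Complex.I) * (x : ℂ) ^ (-(u + t * Complex.I)) := by
  have hmel : ∀ t : ℝ, mellin (fun x : ℝ => (Real.exp (-x) : ℂ)) (u + t * Complex.I) =
      Complex.Gamma (u + t * Complex.I) := fun t => by
    rw [← Complex.GammaIntegral_eq_mellin, Complex.Gamma_eq_integral (by simp [hu])]
  have hconv : MellinConvergent (fun x : ℝ => (Real.exp (-x) : ℂ)) (u : ℂ) := by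
    refine (Complex.GammaIntegral_convergent (s := u) (by simpa using hu)).congr_fun
      (fun y _ => ?_) measurableSet_Ioi
    simp [mul_comm]
  have hvert : Complex.VerticalIntegrable (mellin fun x : ℝ => (Real.exp (-x) : ℂ)) u := by
    simpa only [Complex.VerticalIntegrable, hmel] using Complex.verticalIntegrable_Gamma hu
  have h := mellinInv_mellin_eq u _ hx hconv hvert (by fun_prop)
  rw [← h, mellinInv]
  simp only [hmel, smul_eq_mul]
  rw [Complex.real_smul]
  push_cast
  simp only [mul_comm, one_div]

/-- The Laplace functional `∫ exp (-f)` as a Mellin–Barnes integral of the moments of `f`. -/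
theorem MeasureTheory.integral_exp_neg_eq_integral_Gamma {E : Type*} [MeasurableSpace E]
    (μ : Measure E) [SFinite μ] {f : E → ℝ} {u : ℝ} (hu : 0 < u) (hf : AEMeasurable f μ)
    (hpos : ∀ᵐ x ∂μ, 0 < f x) (hint : Integrable (fun x => f x ^ (-u)) μ) :
    ((∫ x, Real.exp (-f x) ∂μ : ℝ) : ℂ) = (2 * Real.pi : ℂ)⁻¹ *
      ∫ t : ℝ, Complex.Gamma (u + t * Complex.I) *
        ∫ x, (f x : ℂ) ^ (-(u + t * Complex.I)) ∂μ := by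
  have hG := Complex.verticalIntegrable_Gamma hu
  -- Fubini's hypothesis: since |f^(-(u+it))| = f^(-u), the integrand is dominated by a product of a
  -- function of x and a function of t.
  have hF : Integrable (Function.uncurry fun (x : E) (t : ℝ) =>
      Complex.Gamma (u + t * Complex.I) * (f x : ℂ) ^ (-(u + t * Complex.I : ℂ)))
      (μ.prod volume) := by
    refine Integrable.mono' (hint.mul_prod hG.norm) ?_ ?_
    · refine AEStronglyMeasurable.mul ?_ ?_
      · exact hG.aestronglyMeasurable.comp_snd
      · refine AEMeasurable.aestronglyMeasurable ?_
        have h1 : AEMeasurable (fun p : E × ℝ => (f p.1 : ℂ)) (μ.prod volume) :=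
          Complex.measurable_ofReal.comp_aemeasurable hf.comp_fst
        exact h1.pow (by fun_prop)
    · have := Measure.quasiMeasurePreserving_fst (μ := μ) (ν := (volume : Measure ℝ))
      filter_upwards [this.ae hpos] with p hp
      simp only [Function.uncurry, norm_mul, Complex.norm_cpow_eq_rpow_re_of_pos hp]
      simp [mul_comm]
  calc ((∫ x, Real.exp (-f x) ∂μ : ℝ) : ℂ) = ∫ x, (Real.exp (-f x) : ℂ) ∂μ :=
        (integral_ofReal).symm
    _ = ∫ x, (2 * Real.pi : ℂ)⁻¹ * (∫ t : ℝ, Complex.Gamma (u + t * Complex.I) *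
          (f x : ℂ) ^ (-(u + t * Complex.I))) ∂μ := by
        refine integral_congr_ae ?_
        filter_upwards [hpos] with x hx
        exact Real.exp_neg_eq_integral_Gamma hu hx
    _ = _ := by
        rw [integral_const_mul, integral_integral_swap hF]
        simp only [integral_const_mul]

/-! ### Complex moments of the sine -/

/-- The substitution y = sin²θ in the Beta integral B(w + 1/2, 1/2) yields twice this moment, and
Γ(1/2) = √π. -/
theorem integral_sin_sq_cpow {w : ℂ} (hw : 0 < w.re) :
    ∫ θ in Set.Ioo 0 (Real.pi / 2), ((Real.sin θ ^ 2 : ℝ) : ℂ) ^ w =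
      Real.sqrt Real.pi / 2 * (Complex.Gamma (w + 1 / 2) / Complex.Gamma (w + 1)) := by
  have hpi := Real.pi_pos
  have hsin : ∀ θ ∈ Set.Ioo 0 (Real.pi / 2), 0 < Real.sin θ := fun θ h =>
    Real.sin_pos_of_pos_of_lt_pi h.1 (by linarith [h.2])
  have hcos : ∀ θ ∈ Set.Ioo 0 (Real.pi / 2), 0 < Real.cos θ := fun θ h =>
    Real.cos_pos_of_mem_Ioo ⟨by linarith [h.1], h.2⟩
  have hinj : Set.InjOn (fun θ => Real.sin θ ^ 2) (Set.Ioo 0 (Real.pi / 2)) := by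
    intro a ha b hb hab
    have h1 : Real.sin a = Real.sin b :=
      (pow_left_inj₀ (hsin a ha).le (hsin b hb).le two_ne_zero).1 hab
    exact Real.injOn_sin ⟨by linarith [ha.1], ha.2.le⟩ ⟨by linarith [hb.1], hb.2.le⟩ h1
  have himg : (fun θ => Real.sin θ ^ 2) '' Set.Ioo 0 (Real.pi / 2) = Set.Ioo 0 1 := by
    ext y
    constructor
    · rintro ⟨θ, h, rfl⟩
      refine ⟨pow_pos (hsin θ h) 2, ?_⟩
      have := Real.sin_sq_add_cos_sq θ
      have := pow_pos (hcos θ h) 2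
      simp only
      linarith
    · rintro ⟨h0, h1⟩
      have hs : Real.sqrt y < 1 := by rwa [Real.sqrt_lt' one_pos, one_pow]
      refine ⟨Real.arcsin (Real.sqrt y), ⟨Real.arcsin_pos.2 (Real.sqrt_pos.2 h0),
        Real.arcsin_lt_pi_div_two.2 hs⟩, ?_⟩
      simp only
      rw [Real.sin_arcsin (by linarith [Real.sqrt_nonneg y]) hs.le, Real.sq_sqrt h0.le]
  have hbeta : Complex.betaIntegral (w + 1 / 2) (1 / 2) =
      2 * ∫ θ in Set.Ioo 0 (Real.pi / 2), ((Real.sin θ ^ 2 : ℝ) : ℂ) ^ w := by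
    rw [Complex.betaIntegral, intervalIntegral.integral_of_le zero_le_one,
      integral_Ioc_eq_integral_Ioo, ← himg,
      integral_image_eq_integral_abs_deriv_smul measurableSet_Ioo
        (f' := fun θ => 2 * Real.sin θ * Real.cos θ)
        (fun θ _ => by
          simpa using ((Real.hasDerivAt_sin θ).fun_pow 2).hasDerivWithinAt) hinj,
      ← integral_const_mul]
    refine setIntegral_congr_fun measurableSet_Ioo fun θ h => ?_
    have hs := hsin θ h
    have hc := hcos θ h
    have hc2 : (1 : ℂ) - ((Real.sin θ ^ 2 : ℝ) : ℂ) = ((Real.cos θ ^ 2 : ℝ) : ℂ) := by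
      rw [← Complex.ofReal_one, ← Complex.ofReal_sub]
      congr 1
      linarith [Real.sin_sq_add_cos_sq θ]
    -- With every power written as an exponential of logarithms, the identity 2 sin θ cos θ ·
    -- (sin²θ)^(w-1/2) (cos²θ)^(-1/2) = 2 (sin²θ)^w becomes linear in the exponents.
    rw [hc2, abs_of_pos (by positivity), Complex.real_smul,
      Complex.ofReal_cpow_eq_exp_log (by positivity),
      Complex.ofReal_cpow_eq_exp_log (by positivity),
      Complex.ofReal_cpow_eq_exp_log (by positivity), Real.log_pow, Real.log_pow]
    have es : (Real.sin θ : ℂ) = Complex.exp (Real.log (Real.sin θ)) := by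
      rw [← Complex.ofReal_exp, Real.exp_log hs]
    have ec : (Real.cos θ : ℂ) = Complex.exp (Real.log (Real.cos θ)) := by
      rw [← Complex.ofReal_exp, Real.exp_log hc]
    rw [Complex.ofReal_mul, Complex.ofReal_mul, es, ec, Complex.ofReal_ofNat, mul_assoc, mul_assoc]
    congr 1
    rw [← Complex.exp_add, ← Complex.exp_add, ← Complex.exp_add]
    congr 1
    push_cast
    ring
  have hΓ := Complex.Gamma_mul_Gamma_eq_betaIntegral (s := w + 1 / 2) (t := 1 / 2)
    (by simp; linarith) (by simp)
  have h1 : w + 1 / 2 + 1 / 2 = w + 1 := by ring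
  have h0 : Complex.Gamma (w + 1) ≠ 0 :=
    Complex.Gamma_ne_zero_of_re_pos (by simp; linarith)
  rw [h1, hbeta, Complex.Gamma_one_half_eq] at hΓ
  have hsq : (Real.pi : ℂ) ^ (1 / 2 : ℂ) = (Real.sqrt Real.pi : ℂ) := by
    rw [Real.sqrt_eq_rpow, Complex.ofReal_cpow hpi.le]; simp
  rw [hsq] at hΓ
  rw [← mul_div_assoc, eq_div_iff h0]
  linear_combination -hΓ / 2

/-! ### Moments of the Gamma distribution -/

/-- The half-line x ≤ 0 is null. Discarding it makes the laws of complex powers of positive bases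
available. -/
theorem gammaMeasure_eq_withDensity_restrict (a r : ℝ) :
    gammaMeasure a r = (volume.restrict (Set.Ioi 0)).withDensity (gammaPDF a r) := by
  rw [gammaMeasure, ← restrict_withDensity measurableSet_Ioi, eq_comm,
    Measure.restrict_eq_self_of_ae_mem]
  rw [ae_iff, withDensity_apply' _ _]
  have : {x : ℝ | ¬ x ∈ Set.Ioi 0} = Set.Iic 0 := by ext; simp
  rw [this, setLIntegral_congr Iio_ae_eq_Iic.symm, lintegral_gammaPDF_of_nonpos le_rfl]

theorem ae_pos_gammaMeasure (a r : ℝ) : ∀ᵐ x ∂gammaMeasure a r, 0 < x := by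
  rw [gammaMeasure_eq_withDensity_restrict]
  exact (withDensity_absolutelyContinuous _ _).ae_le (ae_restrict_mem measurableSet_Ioi)

theorem measurable_gammaPDF (a r : ℝ) : Measurable (gammaPDF a r) :=
  (measurable_gammaPDFReal a r).ennreal_ofReal

theorem integral_gammaMeasure {a r : ℝ} (ha : 0 < a) (hr : 0 < r) (f : ℝ → ℂ) :
    ∫ x, f x ∂gammaMeasure a r = ∫ x in Set.Ioi 0, (gammaPDFReal a r x : ℂ) * f x := by
  rw [gammaMeasure_eq_withDensity_restrict,
    integral_withDensity_eq_integral_toReal_smul (measurable_gammaPDF a r)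
      (Filter.Eventually.of_forall fun _ => ENNReal.ofReal_lt_top)]
  refine integral_congr_ae (Filter.Eventually.of_forall fun x => ?_)
  simp [gammaPDF, ENNReal.toReal_ofReal (gammaPDFReal_nonneg ha hr x)]

theorem integrable_gammaMeasure_iff {a r : ℝ} (ha : 0 < a) (hr : 0 < r) (f : ℝ → ℂ) :
    Integrable f (gammaMeasure a r) ↔
      IntegrableOn (fun x => (gammaPDFReal a r x : ℂ) * f x) (Set.Ioi 0) := by
  rw [gammaMeasure_eq_withDensity_restrict,
    integrable_withDensity_iff_integrable_smul' (measurable_gammaPDF a r)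
      (Filter.Eventually.of_forall fun _ => ENNReal.ofReal_lt_top)]
  refine integrable_congr (Filter.Eventually.of_forall fun x => ?_)
  simp [gammaPDF, ENNReal.toReal_ofReal (gammaPDFReal_nonneg ha hr x)]

theorem gammaPDFReal_mul_cpow {a r x : ℝ} (hx : 0 < x) (s : ℂ) :
    (gammaPDFReal a r x : ℂ) * (x : ℂ) ^ s =
      ((r ^ a / Real.Gamma a : ℝ) : ℂ) * ((x : ℂ) ^ (a + s - 1) * Complex.exp (-(r * x))) := by
  have h : (x : ℂ) ^ (a + s - 1) = ((x ^ (a - 1) : ℝ) : ℂ) * (x : ℂ) ^ s := by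
    rw [Complex.ofReal_cpow hx.le, ← Complex.cpow_add _ _ (by exact_mod_cast hx.ne')]
    congr 1
    push_cast
    ring
  rw [gammaPDFReal, if_pos hx.le, h]
  push_cast
  ring

theorem integrable_cpow_gammaMeasure {a r : ℝ} (ha : 0 < a) (hr : 0 < r) {s : ℂ}
    (hs : 0 < a + s.re) : Integrable (fun x : ℝ => (x : ℂ) ^ s) (gammaMeasure a r) := by
  rw [integrable_gammaMeasure_iff ha hr]
  have hint : IntegrableOn (fun x : ℝ => (x : ℂ) ^ (a + s - 1) * Complex.exp (-(r * x)))
      (Set.Ioi 0) := by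
    refine Integrable.mono' (integrableOn_rpow_mul_exp_neg_mul_rpow (p := 1) (b := r)
      (s := a + s.re - 1) (by linarith) one_pos hr) ?_ ?_
    · refine Measurable.aestronglyMeasurable ?_
      fun_prop
    · refine (ae_restrict_mem measurableSet_Ioi).mono fun x (hx : 0 < x) => le_of_eq ?_
      rw [norm_mul, Complex.norm_cpow_eq_rpow_re_of_pos hx, Complex.norm_exp]
      simp
  refine IntegrableOn.congr_fun (hint.const_mul ((r ^ a / Real.Gamma a : ℝ) : ℂ))
    (fun x hx => ?_) measurableSet_Ioi
  exact (gammaPDFReal_mul_cpow hx s).symm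

/-- The factor x^s shifts the shape parameter from a to a + s, leaving Euler's integral. -/
theorem integral_cpow_gammaMeasure {a r : ℝ} (ha : 0 < a) (hr : 0 < r) {s : ℂ}
    (hs : 0 < a + s.re) :
    ∫ x, (x : ℂ) ^ s ∂gammaMeasure a r =
      (r : ℂ) ^ (-s) * (Complex.Gamma (a + s) / Complex.Gamma a) := by
  rw [integral_gammaMeasure ha hr,
    setIntegral_congr_fun measurableSet_Ioi fun x hx => gammaPDFReal_mul_cpow hx s,
    integral_const_mul, Complex.integral_cpow_mul_exp_neg_mul_Ioi (by simpa using hs) hr,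
    one_div, Complex.inv_cpow _ _ (by rw [Complex.arg_ofReal_of_nonneg hr.le]; exact Real.pi_pos.ne),
    ← Complex.cpow_neg, Complex.ofReal_div, Complex.ofReal_cpow hr.le, Complex.Gamma_ofReal,
    neg_add, Complex.cpow_add _ _ (by exact_mod_cast hr.ne'), Complex.cpow_neg _ (a : ℂ)]
  have : (r : ℂ) ^ (a : ℂ) ≠ 0 := by
    rw [← Complex.ofReal_cpow hr.le]
    exact_mod_cast (Real.rpow_pos_of_pos hr a).ne'
  field_simp

/-! ### The squared radius of a planar Gaussian -/

/-- In polar coordinates the joint density is (t/π) exp(-t r²). The angle contributes 2π, and y = r²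
turns 2t r exp(-t r²) dr into the exponential law t exp(-t y) dy. -/
theorem map_sq_add_sq_gaussianReal_prod {t : ℝ} (ht : 0 < t) :
    ((gaussianReal 0 (1 / (2 * t)).toNNReal).prod (gaussianReal 0 (1 / (2 * t)).toNNReal)).map
      (fun p : ℝ × ℝ => p.1 ^ 2 + p.2 ^ 2) = gammaMeasure 1 t := by
  have hpi := Real.pi_pos
  set v := (1 / (2 * t)).toNNReal with hv
  have hv0 : v ≠ 0 := by simp [hv, ht]
  have hvt : (v : ℝ) = 1 / (2 * t) := Real.coe_toNNReal _ (by positivity)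
  refine Measure.ext_of_lintegral _ fun f hf => ?_
  have hm : Measurable fun p : ℝ × ℝ => p.1 ^ 2 + p.2 ^ 2 := by fun_prop
  have hdens : ∀ x y : ℝ, gaussianPDF 0 v x * gaussianPDF 0 v y =
      ENNReal.ofReal (t / Real.pi * Real.exp (-(t * (x ^ 2 + y ^ 2)))) := fun x y => by
    rw [gaussianPDF, gaussianPDF, ← ENNReal.ofReal_mul (gaussianPDFReal_nonneg _ _ _)]
    congr 1
    rw [gaussianPDFReal, gaussianPDFReal, hvt, mul_mul_mul_comm, ← Real.exp_add, ← mul_inv,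
      Real.mul_self_sqrt (by positivity)]
    congr 1
    · field_simp
    · congr 1; field_simp; ring
  rw [lintegral_map hf hm, gaussianReal_of_var_ne_zero 0 hv0,
    prod_withDensity (measurable_gaussianPDF 0 v) (measurable_gaussianPDF 0 v),
    lintegral_withDensity_eq_lintegral_mul _ (by fun_prop)
      (g := fun p : ℝ × ℝ => f (p.1 ^ 2 + p.2 ^ 2)) (by fun_prop)]
  have h1 : ∀ p : ℝ × ℝ, ((fun z : ℝ × ℝ => gaussianPDF 0 v z.1 * gaussianPDF 0 v z.2) *
      (fun p : ℝ × ℝ => f (p.1 ^ 2 + p.2 ^ 2))) p =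
      ENNReal.ofReal (t / Real.pi * Real.exp (-(t * (p.1 ^ 2 + p.2 ^ 2)))) *
        f (p.1 ^ 2 + p.2 ^ 2) := fun p => by
    simp only [Pi.mul_apply, hdens]
  rw [lintegral_congr h1, ← Measure.volume_eq_prod, ← lintegral_comp_polarCoord_symm]
  have h2 : ∀ p : ℝ × ℝ, (polarCoord.symm p).1 ^ 2 + (polarCoord.symm p).2 ^ 2 = p.1 ^ 2 :=
    fun p => by
      simp only [polarCoord_symm_apply]
      linear_combination p.1 ^ 2 * Real.sin_sq_add_cos_sq p.2
  simp only [h2, polarCoord_target]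
  rw [Measure.volume_eq_prod, ← Measure.prod_restrict, lintegral_prod _ (by fun_prop)]
  simp only [lintegral_const, Measure.restrict_apply_univ, Real.volume_Ioo]
  have himg : (fun x : ℝ => x ^ 2) '' Set.Ioi 0 = Set.Ioi 0 := by
    ext y
    constructor
    · rintro ⟨x, hx, rfl⟩
      exact pow_pos (Set.mem_Ioi.1 hx) 2
    · exact fun hy => ⟨Real.sqrt y, Real.sqrt_pos.2 hy, Real.sq_sqrt (le_of_lt hy)⟩
  have hinj : Set.InjOn (fun x : ℝ => x ^ 2) (Set.Ioi 0) := fun a ha b hb hab =>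
    (pow_left_inj₀ (le_of_lt ha) (le_of_lt hb) two_ne_zero).1 hab
  rw [gammaMeasure_eq_withDensity_restrict,
    lintegral_withDensity_eq_lintegral_mul _ (measurable_gammaPDF 1 t) hf]
  conv_rhs => rw [← himg]
  rw [lintegral_image_eq_lintegral_abs_deriv_mul measurableSet_Ioi (f' := fun x => 2 * x)
    (fun x _ => by simpa using (hasDerivAt_pow 2 x).hasDerivWithinAt) hinj]
  refine setLIntegral_congr_fun measurableSet_Ioi fun x (hx : 0 < x) => ?_
  simp only [Pi.mul_apply, smul_eq_mul]
  rw [gammaPDF_of_nonneg (by positivity), abs_of_pos (by positivity), mul_comm _ (f _),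
    mul_left_comm, mul_assoc, ← mul_assoc (ENNReal.ofReal (2 * x)), mul_comm _ (f _)]
  congr 1
  rw [← ENNReal.ofReal_mul (by positivity), ← ENNReal.ofReal_mul (by positivity),
    ← ENNReal.ofReal_mul (by positivity)]
  congr 1
  simp
  field_simp
  ring

namespace AlphaLomax

/-! ### The squared envelope of Lomax fading -/

theorem gaussianKernel_prod_map {t : ℝ} (ht : 0 < t) :
    ((gaussianKernel ×ₖ gaussianKernel) t).map (fun p : ℝ × ℝ => p.1 ^ 2 + p.2 ^ 2) =
      gammaMeasure 1 t := by
  rw [Kernel.prod_apply]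
  exact map_sq_add_sq_gaussianReal_prod ht

/-- The norm of r^s is r^(Re s). The value is kept as the real part of a complex expression so that
its integrability in t follows from that of a complex power. -/
theorem integral_norm_cpow_gammaMeasure_one {t : ℝ} (ht : 0 < t) {s : ℂ} (hs : -1 < s.re) :
    ∫ r : ℝ, ‖(r : ℂ) ^ s‖ ∂gammaMeasure 1 t =
      ((t : ℂ) ^ (-(s.re : ℂ)) * (Complex.Gamma (1 + s.re) / Complex.Gamma 1)).re := by
  have h := integral_cpow_gammaMeasure (a := 1) one_pos ht (s := s.re) (by simp; linarith)
  rw [Complex.ofReal_one] at h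
  rw [← h, ← Complex.ofReal_re (∫ r : ℝ, ‖(r : ℂ) ^ s‖ ∂gammaMeasure 1 t), ← integral_complex_ofReal]
  congr 1
  refine integral_congr_ae ?_
  filter_upwards [ae_pos_gammaMeasure 1 t] with r hr
  rw [Complex.norm_cpow_eq_rpow_re_of_pos hr]
  exact Complex.ofReal_cpow hr.le _

section Model

variable {Ω : Type*} [MeasurableSpace Ω] {P : Measure Ω} {lam β : ℝ} {τ X Y : Ω → ℝ}

/-- The bound -1 < Re s makes the conditional exponential moment finite; Re s < λ makes τ^(-Re s)
integrable for the Gamma law. -/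
theorem integrable_envelope_cpow_compProd (hlam : 0 < lam) (hβ : 0 < β) {s : ℂ}
    (h1 : -1 < s.re) (h2 : s.re < lam) :
    Integrable (fun p : ℝ × ℝ × ℝ => ((p.2.1 ^ 2 + p.2.2 ^ 2 : ℝ) : ℂ) ^ s)
      (gammaMeasure lam β ⊗ₘ (gaussianKernel ×ₖ gaussianKernel)) := by
  have := isProbabilityMeasure_gammaMeasure hlam hβ
  have hq : Measurable fun p : ℝ × ℝ => p.1 ^ 2 + p.2 ^ 2 := by fun_prop
  have hg : Measurable fun r : ℝ => (r : ℂ) ^ s := by fun_prop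
  rw [Measure.integrable_compProd_iff (Measurable.aestronglyMeasurable (by fun_prop))]
  constructor
  · filter_upwards [ae_pos_gammaMeasure lam β] with t ht
    have h := integrable_cpow_gammaMeasure one_pos ht (s := s) (by linarith)
    rw [← gaussianKernel_prod_map ht] at h
    exact h.comp_measurable hq
  · have h := ((integrable_cpow_gammaMeasure hlam hβ (s := -(s.re : ℂ))
      (by simp; linarith)).mul_const (Complex.Gamma (1 + s.re) / Complex.Gamma 1)).re
    refine h.congr ?_
    filter_upwards [ae_pos_gammaMeasure lam β] with t ht
    have h' := integral_norm_cpow_gammaMeasure_one ht h1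
    rw [← gaussianKernel_prod_map ht, integral_map hq.aemeasurable
      hg.norm.aestronglyMeasurable] at h'
    exact h'.symm

theorem integral_envelope_cpow_compProd (hlam : 0 < lam) (hβ : 0 < β) {s : ℂ}
    (h1 : -1 < s.re) (h2 : s.re < lam) :
    ∫ p, ((p.2.1 ^ 2 + p.2.2 ^ 2 : ℝ) : ℂ) ^ s
        ∂(gammaMeasure lam β ⊗ₘ (gaussianKernel ×ₖ gaussianKernel)) =
      (β : ℂ) ^ s * (Complex.Gamma (1 + s) * Complex.Gamma (lam - s) / Complex.Gamma lam) := by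
  have := isProbabilityMeasure_gammaMeasure hlam hβ
  have hq : Measurable fun p : ℝ × ℝ => p.1 ^ 2 + p.2 ^ 2 := by fun_prop
  have hg : Measurable fun r : ℝ => (r : ℂ) ^ s := by fun_prop
  rw [Measure.integral_compProd (integrable_envelope_cpow_compProd hlam hβ h1 h2)]
  have hin : ∀ᵐ t ∂gammaMeasure lam β,
      ∫ p : ℝ × ℝ, ((p.1 ^ 2 + p.2 ^ 2 : ℝ) : ℂ) ^ s ∂(gaussianKernel ×ₖ gaussianKernel) t =
        (t : ℂ) ^ (-s) * Complex.Gamma (1 + s) := by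
    filter_upwards [ae_pos_gammaMeasure lam β] with t ht
    have h := integral_cpow_gammaMeasure one_pos ht (s := s) (by linarith)
    rw [← gaussianKernel_prod_map ht, integral_map hq.aemeasurable hg.aestronglyMeasurable] at h
    rw [h]
    simp
  rw [integral_congr_ae hin, integral_mul_const,
    integral_cpow_gammaMeasure hlam hβ (s := -s) (by simp; linarith), neg_neg, ← sub_eq_add_neg]
  ring

theorem IsLomaxModel.aemeasurable_triple (h : IsLomaxModel P lam β τ X Y) :
    AEMeasurable (fun ω => (τ ω, X ω, Y ω)) P :=
  h.aemeasurable_tau.prodMk (h.aemeasurable_X.prodMk h.aemeasurable_Y)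

theorem IsLomaxModel.aemeasurable_envelope (h : IsLomaxModel P lam β τ X Y) :
    AEMeasurable (fun ω => X ω ^ 2 + Y ω ^ 2) P :=
  (h.aemeasurable_X.pow_const 2).add (h.aemeasurable_Y.pow_const 2)

theorem IsLomaxModel.integrable_envelope_cpow (h : IsLomaxModel P lam β τ X Y)
    (hlam : 0 < lam) (hβ : 0 < β) {s : ℂ} (h1 : -1 < s.re) (h2 : s.re < lam) :
    Integrable (fun ω => ((X ω ^ 2 + Y ω ^ 2 : ℝ) : ℂ) ^ s) P := by
  have hint := integrable_envelope_cpow_compProd hlam hβ h1 h2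
  rw [← h.law] at hint
  exact hint.comp_aemeasurable h.aemeasurable_triple

theorem IsLomaxModel.integral_envelope_cpow (h : IsLomaxModel P lam β τ X Y)
    (hlam : 0 < lam) (hβ : 0 < β) {s : ℂ} (h1 : -1 < s.re) (h2 : s.re < lam) :
    ∫ ω, ((X ω ^ 2 + Y ω ^ 2 : ℝ) : ℂ) ^ s ∂P =
      (β : ℂ) ^ s * (Complex.Gamma (1 + s) * Complex.Gamma (lam - s) / Complex.Gamma lam) := by
  have hint := integral_envelope_cpow_compProd hlam hβ h1 h2
  rw [← h.law, integral_map h.aemeasurable_triple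
    (Measurable.aestronglyMeasurable (by fun_prop))] at hint
  exact hint

theorem IsLomaxModel.ae_envelope_pos (h : IsLomaxModel P lam β τ X Y)
    (hlam : 0 < lam) (hβ : 0 < β) : ∀ᵐ ω ∂P, 0 < X ω ^ 2 + Y ω ^ 2 := by
  have := isProbabilityMeasure_gammaMeasure hlam hβ
  have hq : Measurable fun p : ℝ × ℝ => p.1 ^ 2 + p.2 ^ 2 := by fun_prop
  have hset : MeasurableSet {p : ℝ × ℝ × ℝ | 0 < p.2.1 ^ 2 + p.2.2 ^ 2} :=
    measurableSet_lt (by fun_prop) (by fun_prop)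
  have hae : ∀ᵐ p ∂P.map (fun ω => (τ ω, X ω, Y ω)), 0 < p.2.1 ^ 2 + p.2.2 ^ 2 := by
    rw [h.law, Measure.ae_compProd_iff hset]
    filter_upwards [ae_pos_gammaMeasure lam β] with t ht
    have := ae_pos_gammaMeasure 1 t
    rw [← gaussianKernel_prod_map ht] at this
    exact ae_of_ae_map hq.aemeasurable this
  exact ae_of_ae_map h.aemeasurable_triple hae

theorem IsLomaxModel.integral_fading {α : ℝ} (h : IsLomaxModel P lam β τ X Y)
    (hα : 0 < α) (hlam : 1 / α < lam) (hβ : 0 < β) :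
    ∫ ω, fading α X Y ω ∂P = β ^ (1 / α) * zeta α lam ^ (1 / α) := by
  have hα' : 0 < 1 / α := by positivity
  have hlam0 : 0 < lam := hα'.trans hlam
  have hm := h.integral_envelope_cpow hlam0 hβ (s := ((1 / α : ℝ) : ℂ))
    (by rw [Complex.ofReal_re]; linarith) (by rwa [Complex.ofReal_re])
  have hΓ : 0 ≤ Real.Gamma (1 + 1 / α) * Real.Gamma (lam - 1 / α) / Real.Gamma lam := by
    have := Real.Gamma_pos_of_pos (show 0 < 1 + 1 / α by linarith)
    have := Real.Gamma_pos_of_pos (show 0 < lam - 1 / α by linarith)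
    have := Real.Gamma_pos_of_pos hlam0
    positivity
  rw [zeta, ← Real.rpow_mul hΓ, mul_one_div_cancel hα.ne', Real.rpow_one]
  apply Complex.ofReal_injective
  rw [← integral_complex_ofReal]
  calc ∫ ω, ((fading α X Y ω : ℝ) : ℂ) ∂P
      = ∫ ω, ((X ω ^ 2 + Y ω ^ 2 : ℝ) : ℂ) ^ ((1 / α : ℝ) : ℂ) ∂P := by
        refine integral_congr_ae (Filter.Eventually.of_forall fun ω => ?_)
        exact Complex.ofReal_cpow (by positivity) _
    _ = _ := by
        rw [hm, ← Complex.ofReal_cpow hβ.le]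
        push_cast [← Complex.Gamma_ofReal]
        rfl

end Model

end AlphaLomax

namespace AlphaLomax

/-! ### The Mellin–Barnes integrand -/

theorem integrand_eq (α lam : ℝ) (z s : ℂ) :
    FoxH.integrand 1 4 (upper α lam) (lower α) z s =
      Complex.Gamma (1 + s) * (Complex.Gamma (1 - α * s))⁻¹ *
        (Complex.Gamma (1 / 2 - α * s) * Real.sqrt Real.pi * Complex.Gamma (lam - s) *
          Complex.Gamma (-(α * s))) * z ^ (-s) := by
  have hsq : Complex.Gamma (1 - 1 / 2) = (Real.sqrt Real.pi : ℂ) := by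
    rw [← Real.Gamma_one_half_eq, ← Complex.Gamma_ofReal]
    norm_num
  have hhalf : (1 : ℂ) - 1 / 2 = 1 / 2 := by norm_num
  rw [FoxH.integrand, Fin.prod_univ_two, Fin.prod_univ_four, ← hsq, hhalf]
  simp [upper, lower]
  norm_num

/-- The binding poles are s = -1, from Γ(1+s), and s = 0, from Γ(-αs). The poles of Γ(1/2-αs) and
Γ(λ-s) have positive real part. -/
theorem separates_iff {α lam : ℝ} (hα : 0 < α) (hlam : 0 < lam) (c : ℝ) :
    FoxH.Separates 1 4 (upper α lam) (lower α) c ↔ -1 < c ∧ c < 0 := by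
  constructor
  · rintro ⟨hb, ha⟩
    constructor
    · simpa using hb 0 (by simp) (-1) 0 (by simp [lower])
    · simpa using ha 3 (by simp) 0 0 (by simp [upper])
  · rintro ⟨h1, h0⟩
    constructor
    · intro j hj s k h
      have hj0 : j = 0 := by omega
      subst hj0
      have hre := congrArg Complex.re h
      simp [lower] at hre
      have : (0 : ℝ) ≤ k := k.cast_nonneg
      linarith
    · intro j _ s k h
      have hk : (0 : ℝ) ≤ k := k.cast_nonneg
      have hre := congrArg Complex.re h
      refine h0.trans_le ?_
      fin_cases j
      · simp [upper] at hre
        by_contra! hs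
        nlinarith
      -- The pair with A = 0 contributes the constant Γ(1/2), so the pole equation is contradictory.
      · simp [upper] at hre
        norm_num at hre
        linarith
      · simp [upper] at hre
        linarith
      · simp [upper] at hre
        by_contra! hs
        nlinarith

/-- The quotient Γ(-αs)/Γ(1-αs) is -1/(αs). On the line every factor except Γ(1+s) is bounded by its
value at real s = c, so the decay of Γ(1+s) alone gives integrability. -/
theorem integrable_integrand {α lam : ℝ} (hα : 0 < α) (hlam : 0 < lam) {z : ℝ} (hz : 0 < z)
    {c : ℝ} (h1 : -1 < c) (h0 : c < 0) :
    Integrable fun t : ℝ =>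
      FoxH.integrand 1 4 (upper α lam) (lower α) (z : ℂ) (c + t * Complex.I) := by
  have hαc : α * c < 0 := mul_neg_of_pos_of_neg hα h0
  have hG : Integrable fun t : ℝ => Complex.Gamma (1 + (c + t * Complex.I)) := by
    have := Complex.verticalIntegrable_Gamma (u := 1 + c) (by linarith)
    refine this.congr (Filter.Eventually.of_forall fun t => ?_)
    simp only [Complex.ofReal_add, Complex.ofReal_one, add_assoc]
  set B : ℝ → ℂ := fun t => (-(α * (c + t * Complex.I)))⁻¹ *
    (Complex.Gamma (1 / 2 - α * (c + t * Complex.I)) * Real.sqrt Real.pi *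
      Complex.Gamma (lam - (c + t * Complex.I))) * (z : ℂ) ^ (-(c + t * Complex.I)) with hB
  have hne : ∀ t : ℝ, -(α * (c + t * Complex.I) : ℂ) ≠ 0 := fun t h => by
    have := congrArg Complex.re h
    simp at this
    rcases this with h | h <;> linarith
  have hBcont : Continuous B := by
    have hΓ1 : Continuous fun t : ℝ => Complex.Gamma (1 / 2 - α * (c + t * Complex.I)) :=
      Complex.continuous_Gamma_comp (by fun_prop) fun t => by
        simp; linarith
    have hΓ2 : Continuous fun t : ℝ => Complex.Gamma (lam - (c + t * Complex.I)) :=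
      Complex.continuous_Gamma_comp (by fun_prop) fun t => by
        simp; linarith
    have hinv : Continuous fun t : ℝ => (-(α * (c + t * Complex.I) : ℂ))⁻¹ :=
      Continuous.inv₀ (by fun_prop) hne
    have hpow : Continuous fun t : ℝ => (z : ℂ) ^ (-(c + t * Complex.I : ℂ)) := by
      simp only [Complex.ofReal_cpow_eq_exp_log hz]
      fun_prop
    exact (hinv.mul ((hΓ1.mul continuous_const).mul hΓ2)).mul hpow
  have hBbdd : ∀ t, ‖B t‖ ≤ (-(α * c))⁻¹ *
      (Real.Gamma (1 / 2 - α * c) * Real.sqrt Real.pi * Real.Gamma (lam - c)) * z ^ (-c) := by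
    intro t
    have e1 : ‖(-(α * (c + t * Complex.I) : ℂ))⁻¹‖ ≤ (-(α * c))⁻¹ := by
      rw [norm_inv]
      refine inv_anti₀ (by linarith) ?_
      refine le_trans (le_of_eq ?_) (Complex.re_le_norm _)
      simp
    have e2 : ‖Complex.Gamma (1 / 2 - α * (c + t * Complex.I))‖ ≤ Real.Gamma (1 / 2 - α * c) := by
      have := Complex.norm_Gamma_le_Gamma_re (z := 1 / 2 - α * (c + t * Complex.I))
        (by simp; linarith)
      simpa using this
    have e3 : ‖Complex.Gamma (lam - (c + t * Complex.I))‖ ≤ Real.Gamma (lam - c) := by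
      have := Complex.norm_Gamma_le_Gamma_re (z := lam - (c + t * Complex.I))
        (by simp; linarith)
      simpa using this
    have e4 : ‖(z : ℂ) ^ (-(c + t * Complex.I : ℂ))‖ = z ^ (-c) := by
      rw [Complex.norm_cpow_eq_rpow_re_of_pos hz]
      simp
    have p2 : 0 ≤ Real.Gamma (1 / 2 - α * c) := (norm_nonneg _).trans e2
    have p1 : 0 ≤ (-(α * c))⁻¹ := (norm_nonneg _).trans e1
    simp only [hB, norm_mul, e4]
    rw [Complex.norm_real, Real.norm_of_nonneg (Real.sqrt_nonneg _)]
    gcongr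
  refine (hG.bdd_mul hBcont.aestronglyMeasurable
    (Filter.Eventually.of_forall hBbdd)).congr (Filter.Eventually.of_forall fun t => ?_)
  have hn := hne t
  have hΓ : Complex.Gamma (1 - α * (c + t * Complex.I)) =
      -(α * (c + t * Complex.I)) * Complex.Gamma (-(α * (c + t * Complex.I))) := by
    rw [← Complex.Gamma_add_one _ hn]
    ring_nf
  have hΓ0 : Complex.Gamma (-(α * (c + t * Complex.I))) ≠ 0 :=
    Complex.Gamma_ne_zero_of_re_pos (by simp; linarith)
  simp only [integrand_eq, hB]
  rw [hΓ, mul_inv]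
  field_simp

/-! ### The bit error rate -/

theorem cpow_neg_instantaneous {α K r v : ℝ} (hK : 0 < K) (hr : 0 < r) (hv : 0 < v) (w : ℂ) :
    ((K * r ^ (1 / α) / v : ℝ) : ℂ) ^ (-w) =
      (K : ℂ) ^ (-w) * ((r : ℂ) ^ (-w / α) * (v : ℂ) ^ w) := by
  have hr' : 0 < r ^ (1 / α) := Real.rpow_pos_of_pos hr _
  rw [Complex.ofReal_cpow_eq_exp_log (by positivity), Complex.ofReal_cpow_eq_exp_log hK,
    Complex.ofReal_cpow_eq_exp_log hr, Complex.ofReal_cpow_eq_exp_log hv, ← Complex.exp_add,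
    ← Complex.exp_add, Real.log_div (by positivity) hv.ne', Real.log_mul hK.ne' hr'.ne',
    Real.log_rpow hr]
  congr 1
  push_cast
  ring

theorem sin_sq_pos_of_mem_Ioo {θ : ℝ} (h : θ ∈ Set.Ioo 0 (Real.pi / 2)) : 0 < Real.sin θ ^ 2 :=
  pow_pos (Real.sin_pos_of_pos_of_lt_pi h.1 (by linarith [h.2, Real.pi_pos])) 2

section Model

variable {Ω : Type*} [MeasurableSpace Ω] {P : Measure Ω}
  {lam β α γbar φ : ℝ} {τ X Y : Ω → ℝ}

theorem IsLomaxModel.aemeasurable_instantaneous (h : IsLomaxModel P lam β τ X Y) (K : ℝ) :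
    AEMeasurable (fun p : Ω × ℝ =>
        K * (X p.1 ^ 2 + Y p.1 ^ 2) ^ (1 / α) / Real.sin p.2 ^ 2)
      (P.prod (volume.restrict (Set.Ioo 0 (Real.pi / 2)))) := by
  have h1 : AEMeasurable (fun p : Ω × ℝ => X p.1 ^ 2 + Y p.1 ^ 2)
      (P.prod (volume.restrict (Set.Ioo 0 (Real.pi / 2)))) := h.aemeasurable_envelope.comp_fst
  exact ((h1.pow_const _).const_mul K).div (by fun_prop)

theorem IsLomaxModel.ae_prod_pos (h : IsLomaxModel P lam β τ X Y) (hlam : 0 < lam) (hβ : 0 < β) :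
    ∀ᵐ p ∂P.prod (volume.restrict (Set.Ioo 0 (Real.pi / 2))),
      0 < X p.1 ^ 2 + Y p.1 ^ 2 ∧ 0 < Real.sin p.2 ^ 2 := by
  have h1 := (Measure.quasiMeasurePreserving_fst (μ := P)
    (ν := volume.restrict (Set.Ioo 0 (Real.pi / 2)))).ae (h.ae_envelope_pos hlam hβ)
  have h2 := (Measure.quasiMeasurePreserving_snd (μ := P)
    (ν := volume.restrict (Set.Ioo 0 (Real.pi / 2)))).ae (ae_restrict_mem measurableSet_Ioo)
  filter_upwards [h1, h2] with p hp1 hp2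
  exact ⟨hp1, sin_sq_pos_of_mem_Ioo hp2⟩

theorem integrable_sin_sq_cpow {w : ℂ} (hw : 0 < w.re) :
    Integrable (fun θ : ℝ => ((Real.sin θ ^ 2 : ℝ) : ℂ) ^ w)
      (volume.restrict (Set.Ioo 0 (Real.pi / 2))) := by
  refine Integrable.mono' (integrable_const (1 : ℝ))
    (Measurable.aestronglyMeasurable (by fun_prop)) ?_
  filter_upwards [ae_restrict_mem measurableSet_Ioo] with θ hθ
  rw [Complex.norm_cpow_eq_rpow_re_of_pos (sin_sq_pos_of_mem_Ioo hθ)]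
  exact Real.rpow_le_one (by positivity) (Real.sin_sq_le_one θ) hw.le

/-- The envelope enters with exponent -w/α, whose real part lies in (-1, 0) when 0 < Re w < α; the
upper limit λ is then automatic. -/
theorem IsLomaxModel.integrable_instantaneous_cpow (h : IsLomaxModel P lam β τ X Y)
    (hlam : 0 < lam) (hβ : 0 < β) (hα : 0 < α) {K : ℝ} (hK : 0 < K) {w : ℂ} (hw : 0 < w.re)
    (hwα : w.re < α) :
    Integrable (fun p : Ω × ℝ =>
        ((K * (X p.1 ^ 2 + Y p.1 ^ 2) ^ (1 / α) / Real.sin p.2 ^ 2 : ℝ) : ℂ) ^ (-w))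
      (P.prod (volume.restrict (Set.Ioo 0 (Real.pi / 2)))) := by
  have hre : (-w / (α : ℂ)).re = -(w.re / α) := by rw [Complex.div_ofReal_re]; simp [neg_div]
  have hlt : w.re / α < 1 := by rwa [div_lt_one hα]
  have hpos : 0 < w.re / α := by positivity
  have hR := h.integrable_envelope_cpow hlam hβ (s := -w / α) (by rw [hre]; linarith)
    (by rw [hre]; linarith)
  refine ((hR.mul_prod (integrable_sin_sq_cpow hw)).const_mul ((K : ℂ) ^ (-w))).congr ?_
  filter_upwards [h.ae_prod_pos hlam hβ] with p hp
  exact (cpow_neg_instantaneous hK hp.1 hp.2 w).symm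

theorem IsLomaxModel.integral_instantaneous_cpow [IsProbabilityMeasure P]
    (h : IsLomaxModel P lam β τ X Y)
    (hlam : 0 < lam) (hβ : 0 < β) (hα : 0 < α) {K : ℝ} (hK : 0 < K) {w : ℂ} (hw : 0 < w.re)
    (hwα : w.re < α) :
    ∫ p : Ω × ℝ, ((K * (X p.1 ^ 2 + Y p.1 ^ 2) ^ (1 / α) / Real.sin p.2 ^ 2 : ℝ) : ℂ) ^ (-w)
        ∂P.prod (volume.restrict (Set.Ioo 0 (Real.pi / 2))) =
      (K : ℂ) ^ (-w) * ((β : ℂ) ^ (-w / α) *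
        (Complex.Gamma (1 + -w / α) * Complex.Gamma (lam - -w / α) / Complex.Gamma lam) *
        (Real.sqrt Real.pi / 2 * (Complex.Gamma (w + 1 / 2) / Complex.Gamma (w + 1)))) := by
  have hre : (-w / (α : ℂ)).re = -(w.re / α) := by rw [Complex.div_ofReal_re]; simp [neg_div]
  have hlt : w.re / α < 1 := by rwa [div_lt_one hα]
  have hpos : 0 < w.re / α := by positivity
  rw [← integral_sin_sq_cpow hw, ← h.integral_envelope_cpow hlam hβ (s := -w / α)
    (by rw [hre]; linarith) (by rw [hre]; linarith), ← integral_prod_mul, ← integral_const_mul]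
  refine integral_congr_ae ?_
  filter_upwards [h.ae_prod_pos hlam hβ] with p hp
  exact cpow_neg_instantaneous hK hp.1 hp.2 w

theorem IsLomaxModel.integrable_exp_neg_instantaneous [IsProbabilityMeasure P]
    (h : IsLomaxModel P lam β τ X Y)
    {K : ℝ} (hK : 0 < K) :
    Integrable (fun p : Ω × ℝ =>
        Real.exp (-(K * (X p.1 ^ 2 + Y p.1 ^ 2) ^ (1 / α) / Real.sin p.2 ^ 2)))
      (P.prod (volume.restrict (Set.Ioo 0 (Real.pi / 2)))) := by
  refine Integrable.mono' (integrable_const (1 : ℝ))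
    (Real.measurable_exp.comp_aemeasurable
      (h.aemeasurable_instantaneous K).neg).aestronglyMeasurable
    (Filter.Eventually.of_forall fun p => ?_)
  rw [Real.norm_of_nonneg (Real.exp_pos _).le, Real.exp_le_one_iff, neg_nonpos]
  have := Real.rpow_nonneg (show 0 ≤ X p.1 ^ 2 + Y p.1 ^ 2 by positivity) (1 / α)
  positivity

theorem laplaceMGF_snr (θ : ℝ) :
    laplaceMGF P (snr P α γbar X Y) (φ / Real.sin θ ^ 2) =
      ∫ ω, Real.exp (-(φ * γbar / (∫ ω', fading α X Y ω' ∂P) *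
        (X ω ^ 2 + Y ω ^ 2) ^ (1 / α) / Real.sin θ ^ 2)) ∂P := by
  simp only [laplaceMGF, mgf, snr, power]
  refine integral_congr_ae (Filter.Eventually.of_forall fun ω => ?_)
  simp only [fading]
  congr 1
  ring

theorem IsLomaxModel.intervalIntegrable_laplaceMGF [IsProbabilityMeasure P]
    (h : IsLomaxModel P lam β τ X Y)
    (hK : 0 < φ * γbar / ∫ ω', fading α X Y ω' ∂P) :
    IntervalIntegrable (fun θ => laplaceMGF P (snr P α γbar X Y) (φ / Real.sin θ ^ 2))
      volume 0 (Real.pi / 2) := by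
  rw [intervalIntegrable_iff_integrableOn_Ioo_of_le (by positivity)]
  simp only [laplaceMGF_snr]
  exact (h.integrable_exp_neg_instantaneous hK).integral_prod_right

theorem IsLomaxModel.averageBER_eq_integral_prod [IsProbabilityMeasure P]
    (h : IsLomaxModel P lam β τ X Y)
    (hK : 0 < φ * γbar / ∫ ω', fading α X Y ω' ∂P) :
    averageBER P (snr P α γbar X Y) φ = 1 / Real.pi *
      ∫ p : Ω × ℝ, Real.exp (-(φ * γbar / (∫ ω', fading α X Y ω' ∂P) *
        (X p.1 ^ 2 + Y p.1 ^ 2) ^ (1 / α) / Real.sin p.2 ^ 2))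
        ∂P.prod (volume.restrict (Set.Ioo 0 (Real.pi / 2))) := by
  rw [averageBER, intervalIntegral.integral_of_le (by positivity), integral_Ioc_eq_integral_Ioo,
    integral_prod_symm _ (h.integrable_exp_neg_instantaneous hK)]
  simp only [laplaceMGF_snr]

theorem zeta_pos (hα : 0 < α) (hlam : 1 / α < lam) : 0 < zeta α lam := by
  have hα' : 0 < 1 / α := by positivity
  have := Real.Gamma_pos_of_pos (show 0 < 1 + 1 / α by linarith)
  have := Real.Gamma_pos_of_pos (show 0 < lam - 1 / α by linarith)
  have := Real.Gamma_pos_of_pos (hα'.trans hlam)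
  exact Real.rpow_pos_of_pos (by positivity) _

/-- Powers of the scale of the signal-to-noise ratio: the rate `β` cancels. -/
theorem scale_cpow_mul {z : ℝ} (hα : 0 < α) (hβ : 0 < β) (hγ : 0 < γbar) (hφ : 0 < φ)
    (hz : 0 < z) (w : ℂ) :
    ((φ * γbar / (β ^ (1 / α) * z ^ (1 / α)) : ℝ) : ℂ) ^ (-w) * (β : ℂ) ^ (-w / α) =
      ((z / (γbar ^ α * φ ^ α) : ℝ) : ℂ) ^ (-(-w / α)) := by
  have h1 : 0 < β ^ (1 / α) := Real.rpow_pos_of_pos hβ _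
  have h2 : 0 < z ^ (1 / α) := Real.rpow_pos_of_pos hz _
  have h3 : 0 < γbar ^ α := Real.rpow_pos_of_pos hγ _
  have h4 : 0 < φ ^ α := Real.rpow_pos_of_pos hφ _
  have hα' : (α : ℂ) ≠ 0 := by exact_mod_cast hα.ne'
  rw [Complex.ofReal_cpow_eq_exp_log (by positivity), Complex.ofReal_cpow_eq_exp_log hβ,
    Complex.ofReal_cpow_eq_exp_log (by positivity), ← Complex.exp_add,
    Real.log_div (by positivity) (by positivity), Real.log_mul hφ.ne' hγ.ne',
    Real.log_mul h1.ne' h2.ne', Real.log_div hz.ne' (by positivity), Real.log_mul h3.ne' h4.ne',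
    Real.log_rpow hβ, Real.log_rpow hz, Real.log_rpow hγ, Real.log_rpow hφ]
  congr 1
  push_cast
  field_simp
  ring

theorem IsLomaxModel.averageBER_eq_lineIntegral [IsProbabilityMeasure P]
    (h : IsLomaxModel P lam β τ X Y)
    (hα : 0 < α) (hlam : 1 / α < lam) (hβ : 0 < β) (hγ : 0 < γbar) (hφ : 0 < φ)
    {c : ℝ} (h1 : -1 < c) (h0 : c < 0) :
    ((averageBER P (snr P α γbar X Y) φ : ℝ) : ℂ) =
      ((α / (2 * Real.pi * Real.Gamma lam) : ℝ) : ℂ) *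
        FoxH.lineIntegral 1 4 (upper α lam) (lower α)
          ((zeta α lam / (γbar ^ α * φ ^ α) : ℝ) : ℂ) c := by
  have hlam0 : 0 < lam := lt_trans (by positivity) hlam
  have hζ := zeta_pos hα hlam
  have hE := h.integral_fading hα hlam hβ
  have hK : 0 < φ * γbar / ∫ ω', fading α X Y ω' ∂P := by
    rw [hE]
    have := Real.rpow_pos_of_pos hβ (1 / α)
    have := Real.rpow_pos_of_pos hζ (1 / α)
    positivity
  -- The abscissa u = -αc is the one that s = -w/α carries to Re s = c; -1 < c < 0 becomes 0 < u <
  -- α.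
  have hu : 0 < -(α * c) := by nlinarith
  have huα : -(α * c) < α := by nlinarith
  have hα' : (α : ℂ) ≠ 0 := by exact_mod_cast hα.ne'
  have hpi : (Real.pi : ℂ) ≠ 0 := by exact_mod_cast Real.pi_pos.ne'
  have hΓ : (Real.Gamma lam : ℂ) ≠ 0 := by exact_mod_cast (Real.Gamma_pos_of_pos hlam0).ne'
  have hint : Integrable (fun p : Ω × ℝ => (φ * γbar / (∫ ω', fading α X Y ω' ∂P) *
      (X p.1 ^ 2 + Y p.1 ^ 2) ^ (1 / α) / Real.sin p.2 ^ 2) ^ (-(-(α * c))))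
      (P.prod (volume.restrict (Set.Ioo 0 (Real.pi / 2)))) := by
    refine (h.integrable_instantaneous_cpow hlam0 hβ hα hK (w := ((-(α * c) : ℝ) : ℂ))
      (by rwa [Complex.ofReal_re]) (by rwa [Complex.ofReal_re])).norm.congr ?_
    filter_upwards [h.ae_prod_pos hlam0 hβ] with p hp
    have := Real.rpow_pos_of_pos hp.1 (1 / α)
    have := hp.2
    rw [Complex.norm_cpow_eq_rpow_re_of_pos (by positivity), Complex.neg_re, Complex.ofReal_re]
  have hpos : ∀ᵐ p ∂P.prod (volume.restrict (Set.Ioo 0 (Real.pi / 2))),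
      0 < φ * γbar / (∫ ω', fading α X Y ω' ∂P) *
        (X p.1 ^ 2 + Y p.1 ^ 2) ^ (1 / α) / Real.sin p.2 ^ 2 := by
    filter_upwards [h.ae_prod_pos hlam0 hβ] with p hp
    have := Real.rpow_pos_of_pos hp.1 (1 / α)
    have := hp.2
    positivity
  set z : ℝ := zeta α lam / (γbar ^ α * φ ^ α) with hz
  -- Here w = u + it and s = c - it/α. The factor 1/(2Γ(λ)) collects the 1/2 of the sine moment and
  -- the 1/Γ(λ) of the envelope moment; √π belongs to the integrand.
  have hterm : ∀ t : ℝ, Complex.Gamma ((-(α * c) : ℝ) + t * Complex.I) *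
      ∫ p : Ω × ℝ, ((φ * γbar / (∫ ω', fading α X Y ω' ∂P) *
        (X p.1 ^ 2 + Y p.1 ^ 2) ^ (1 / α) / Real.sin p.2 ^ 2 : ℝ) : ℂ) ^
          (-((-(α * c) : ℝ) + t * Complex.I))
        ∂P.prod (volume.restrict (Set.Ioo 0 (Real.pi / 2))) =
      (2 * Real.Gamma lam : ℂ)⁻¹ * FoxH.integrand 1 4 (upper α lam) (lower α) z
        (c + (-α⁻¹ * t : ℝ) * Complex.I) := fun t => by
    have hs : (c + (-α⁻¹ * t : ℝ) * Complex.I : ℂ) = -((-(α * c) : ℝ) + t * Complex.I) / α := by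
      push_cast
      field_simp
      ring
    set w : ℂ := (-(α * c) : ℝ) + t * Complex.I with hw
    have hwre : w.re = -(α * c) := by simp [hw]
    have hαs : (α : ℂ) * (-w / α) = -w := by field_simp
    rw [h.integral_instantaneous_cpow hlam0 hβ hα hK (by rwa [hwre]) (by rwa [hwre]), hE, hs,
      integrand_eq, hαs, hz, ← scale_cpow_mul hα hβ hγ hφ hζ, Complex.Gamma_ofReal, neg_neg,
      sub_neg_eq_add, sub_neg_eq_add, add_comm 1 w, add_comm (1 / 2) w]
    field_simp
  -- Rescaling t by -1/α has Jacobian α, which is the α of the closed form.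
  rw [h.averageBER_eq_integral_prod hK, Complex.ofReal_mul,
    integral_exp_neg_eq_integral_Gamma _ hu (h.aemeasurable_instantaneous _) hpos hint,
    integral_congr_ae (Filter.Eventually.of_forall hterm), integral_const_mul,
    Measure.integral_comp_mul_left (fun t : ℝ => FoxH.integrand 1 4 (upper α lam) (lower α) z
        (c + t * Complex.I)) (-α⁻¹), FoxH.lineIntegral, integral_mul_const, Complex.real_smul,
    inv_neg, inv_inv, abs_neg, abs_of_pos hα]
  generalize ∫ t : ℝ, FoxH.integrand 1 4 (upper α lam) (lower α) z (c + t * Complex.I) = J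
  push_cast
  field_simp

end Model

end AlphaLomax

theorem mainTheorem5 {Ω : Type*} [MeasurableSpace Ω] (P : MeasureTheory.Measure Ω)
    [MeasureTheory.IsProbabilityMeasure P] (α lam β γbar φ : ℝ)
    (hα : 0 < α) (hlam : 1 / α < lam) (hβ : 0 < β) (hγbar : 0 < γbar) (hφ : 0 < φ)
    (τ X Y : Ω → ℝ) (hmodel : AlphaLomax.IsLomaxModel P lam β τ X Y) :
    -- the integral that defines the average BER converges
    IntervalIntegrable
      (fun θ : ℝ =>
        AlphaLomax.laplaceMGF P (AlphaLomax.snr P α γbar X Y) (φ / Real.sin θ ^ 2))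
      MeasureTheory.volume 0 (Real.pi / 2) ∧
    -- the Fox H-function is well defined: there is a separating line, and along every such line
    -- the Mellin–Barnes integral converges absolutely and has the same value
    (∃ c : ℝ, FoxH.Separates 1 4 (AlphaLomax.upper α lam) (AlphaLomax.lower α) c) ∧
    (∀ c : ℝ, FoxH.Separates 1 4 (AlphaLomax.upper α lam) (AlphaLomax.lower α) c →
      MeasureTheory.Integrable (fun t : ℝ =>
        FoxH.integrand 1 4 (AlphaLomax.upper α lam) (AlphaLomax.lower α)
          ((AlphaLomax.zeta α lam / (γbar ^ α * φ ^ α) : ℝ) : ℂ) (c + t * Complex.I)) ∧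
      FoxH.lineIntegral 1 4 (AlphaLomax.upper α lam) (AlphaLomax.lower α)
          ((AlphaLomax.zeta α lam / (γbar ^ α * φ ^ α) : ℝ) : ℂ) c =
        foxH 1 4 (AlphaLomax.upper α lam) (AlphaLomax.lower α)
          ((AlphaLomax.zeta α lam / (γbar ^ α * φ ^ α) : ℝ) : ℂ)) ∧
    -- the closed form
    ((AlphaLomax.averageBER P (AlphaLomax.snr P α γbar X Y) φ : ℝ) : ℂ) =
      ((α / (2 * Real.pi * Real.Gamma lam) : ℝ) : ℂ) *
        foxH 1 4 (AlphaLomax.upper α lam) (AlphaLomax.lower α)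
          ((AlphaLomax.zeta α lam / (γbar ^ α * φ ^ α) : ℝ) : ℂ) := by
  have hlam0 : 0 < lam := lt_trans (by positivity) hlam
  have hsep := AlphaLomax.separates_iff hα hlam0
  have hex : ∃ c : ℝ, FoxH.Separates 1 4 (AlphaLomax.upper α lam) (AlphaLomax.lower α) c :=
    ⟨-1 / 2, (hsep _).2 ⟨by norm_num, by norm_num⟩⟩
  have hζ := AlphaLomax.zeta_pos hα hlam
  have hγα := Real.rpow_pos_of_pos hγbar α
  have hφα := Real.rpow_pos_of_pos hφ α
  have hber : ∀ c : ℝ, FoxH.Separates 1 4 (AlphaLomax.upper α lam) (AlphaLomax.lower α) c → _ :=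
    fun c hc => hmodel.averageBER_eq_lineIntegral hα hlam hβ hγbar hφ
      ((hsep c).1 hc).1 ((hsep c).1 hc).2
  have hfox : foxH 1 4 (AlphaLomax.upper α lam) (AlphaLomax.lower α)
      ((AlphaLomax.zeta α lam / (γbar ^ α * φ ^ α) : ℝ) : ℂ) =
      FoxH.lineIntegral 1 4 (AlphaLomax.upper α lam) (AlphaLomax.lower α)
        ((AlphaLomax.zeta α lam / (γbar ^ α * φ ^ α) : ℝ) : ℂ) hex.choose := dif_pos hex
  have hconst : ((α / (2 * Real.pi * Real.Gamma lam) : ℝ) : ℂ) ≠ 0 := by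
    have := Real.Gamma_pos_of_pos hlam0
    exact_mod_cast (show 0 < α / (2 * Real.pi * Real.Gamma lam) by positivity).ne'
  refine ⟨hmodel.intervalIntegrable_laplaceMGF ?_, hex, fun c hc => ⟨?_, ?_⟩, ?_⟩
  · rw [hmodel.integral_fading hα hlam hβ]
    have := Real.rpow_pos_of_pos hβ (1 / α)
    have := Real.rpow_pos_of_pos hζ (1 / α)
    positivity
  · exact AlphaLomax.integrable_integrand hα hlam0 (by positivity)
      ((hsep c).1 hc).1 ((hsep c).1 hc).2
  · rw [hfox]
    -- Both line integrals, multiplied by the same nonzero constant, equal the bit error rate.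
    exact mul_left_cancel₀ hconst ((hber c hc).symm.trans (hber _ hex.choose_spec))
  · rw [hfox]
    exact hber _ hex.choose_spec
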